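/- Matet forcing $\mathbb T$ consists of pairs $(s,A)$, where $s\subseteq\omega$ is finite (equivalently, a strictly increasing finite sequence) and $A$ is an infinite set of nonempty finite subsets of $\omega$, linearly ordered by $a<b:\Leftrightarrow\max a<\min b$, with $s<a$ for all $a\in A$ (where $\emptyset<a$ always). Put $(t,B)\le(s,A)$ iff $s\subseteq t$, every $b\in B$ is a finite union of elements of $A$ (written $B\sqsubseteq A$), and $t\setminus s$ is a (possibly empty) finite union of elements of $A$. For a $\mathbb T$-name $\dot x$ for an element of $2^\omega$ and $q\in\mathbb T$, let $\dot x_q$ be the maximal initial segment of $\dot x$ decided by $q$ (if there is a longest one); let $T_p(\dot x)=\{\dot x_q: q\le p\}$, and let $[T_p(\dot x)]$ be the set of all $y\in2^\omega$ each of whose finite initial segments is an initial segment of an element of $T_p(\dot x)$. A graph $G$ on $2^\omega$ is *closed locally countable* if it is a (relatively) closed subset of $(2^\omega\times2^\omega)\setminus\Delta$, with $\Delta$ the diagonal, and every $y\in2^\omega$ has at most countably many $G$-neighbours. A set is *$G$-independent* if no two of its elements are joined by a $G$-edge. **Theorem (Matet forcing does not add quasi-generics of closed locally countable graphs).** Let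 $G$ be a closed locally countable graph on $2^\omega$. 1. Every element of $2^\omega$ in an extension of the ground model by $\mathbb T$ lies in (the reinterpretation of) a closed $G$-independent set coded in the ground model: for every $\mathbb T$-name $\dot x$ for an element of $2^\omega$ and every $p\in\mathbb T$ there are $q\le p$ and a closed $G$-independent $F\subseteq2^\omega$ with $q\Vdash\dot x\in F$. 2. Let $(s,A)\in\mathbb T$ and let $\dot x$ be a $\mathbb T$-name for an element of $2^\omega$ such that $(s,A)\Vdash\dot x\notin V$. Then there is a condition $(s,C)\le(s,A)$ with the same first coordinate $s$ such that $[T_{(s,C)}(\dot x)]$ is closed and $G$-independent, and $(s,C)\Vdash\dot x\in[T_{(s,C)}(\dot x)]$. Moreover $C$ is obtained as a fusion: there are infinite sets $A_n$ ($n\in\omega$) of nonempty finite subsets of $\omega$, each linearly ordered by $<$, with first elements $a^0_n$, such that $A_0\sqsubseteq A$, $A_{n+1}\sqsubseteq\{a\in A_n: a>a^0_n\}$ for all $n$, and $C=\{a^0_n:n\in\omega\}$. -/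

import Mathlib

namespace MatetForcing

/-! ### Finite subsets of `ω`, block sequences, condensations -/

/-- `a < b` for finite sets of natural numbers: every element of `a` is below every element of
`b` (that is, `max a < min b` if both are nonempty). -/
def Below (a b : Finset ℕ) : Prop := ∀ i ∈ a, ∀ j ∈ b, i < j

/-- `b` is the union of finitely many (possibly zero) elements of `A`. -/
def IsFinUnion (A : Set (Finset ℕ)) (b : Finset ℕ) : Prop :=
  ∃ F : Finset (Finset ℕ), (F : Set (Finset ℕ)) ⊆ A ∧ b = F.biUnion id

/-- `B ⊑ A`: `B` is a condensation of `A`. -/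
def Condenses (B A : Set (Finset ℕ)) : Prop := ∀ b ∈ B, IsFinUnion A b

/-- `A past t`: the elements of `A` lying above the finite set `t`. -/
def past (A : Set (Finset ℕ)) (t : Finset ℕ) : Set (Finset ℕ) := {a ∈ A | Below t a}

/-- An infinite set of nonempty finite subsets of `ω`, linearly ordered by `Below`. -/
structure IsBlockSet (A : Set (Finset ℕ)) : Prop where
  infinite : A.Infinite
  nonempty : ∀ a ∈ A, a.Nonempty
  blocks : ∀ a ∈ A, ∀ b ∈ A, a ≠ b → Below a b ∨ Below b a

/-- `a` is the first element of `A` with respect to `Below`. -/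
def IsFirst (A : Set (Finset ℕ)) (a : Finset ℕ) : Prop := a ∈ A ∧ ∀ b ∈ A, b ≠ a → Below a b

/-- `C` is the fusion of a sequence `A₀, A₁, …` of block sets starting below `A`:
`A₀ ⊑ A`, `Aₙ₊₁ ⊑ Aₙ past aₙ` where `aₙ` is the first element of `Aₙ`, and `C = {aₙ : n ∈ ω}`. -/
def IsFusion (A C : Set (Finset ℕ)) : Prop :=
  ∃ (D : ℕ → Set (Finset ℕ)) (d : ℕ → Finset ℕ),
    Condenses (D 0) A ∧ (∀ n, IsBlockSet (D n)) ∧ (∀ n, IsFirst (D n) (d n)) ∧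
    (∀ n, Condenses (D (n + 1)) (past (D n) (d n))) ∧ C = Set.range d

/-! ### Matet forcing -/

/-- A Matet condition `(s, A)`. The strictly increasing finite sequence `s` is identified with
its range. -/
@[ext]
structure Condition where
  stem : Finset ℕ
  blocks : Set (Finset ℕ)
  isBlockSet : IsBlockSet blocks
  stem_below : ∀ a ∈ blocks, Below stem a

theorem IsFinUnion.union {A : Set (Finset ℕ)} {a b : Finset ℕ} (ha : IsFinUnion A a)
    (hb : IsFinUnion A b) : IsFinUnion A (a ∪ b) := by
  classical
  obtain ⟨F, hF, rfl⟩ := ha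
  obtain ⟨H, hH, rfl⟩ := hb
  refine ⟨F ∪ H, ?_, ?_⟩
  · rw [Finset.coe_union]
    exact Set.union_subset hF hH
  · rw [Finset.union_biUnion]

theorem IsFinUnion.of_mem {A : Set (Finset ℕ)} {a : Finset ℕ} (ha : a ∈ A) : IsFinUnion A a :=
  ⟨{a}, by simpa using ha, by simp⟩

theorem IsFinUnion.empty (A : Set (Finset ℕ)) : IsFinUnion A ∅ := ⟨∅, by simp, by simp⟩

theorem IsFinUnion.mono {A B : Set (Finset ℕ)} (h : Condenses B A) {b : Finset ℕ}
    (hb : IsFinUnion B b) : IsFinUnion A b := by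
  classical
  obtain ⟨F, hF, rfl⟩ := hb
  induction F using Finset.induction_on with
  | empty => simpa using IsFinUnion.empty A
  | insert a F _ ih =>
    rw [Finset.biUnion_insert]
    refine IsFinUnion.union (h a (hF (by simp))) (ih ?_)
    exact fun x hx => hF (by simpa using Or.inr hx)

/-- `(t, B) ≤ (s, A)`: `t` extends `s`, every element of `B` is a finite union of elements of `A`,
and `t \ s` is a finite union of elements of `A`. (As all elements of `A` lie above `s`, the set
`t` is then automatically an end-extension of `s`.) -/
instance : Preorder Condition where
  le q p := p.stem ⊆ q.stem ∧ Condenses q.blocks p.blocks ∧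
    IsFinUnion p.blocks (q.stem \ p.stem)
  le_refl p := ⟨subset_rfl, fun _ hb => IsFinUnion.of_mem hb, by
    simpa using IsFinUnion.empty p.blocks⟩
  le_trans r q p hrq hqp := by
    obtain ⟨h1, h2, h3⟩ := hrq
    obtain ⟨k1, k2, k3⟩ := hqp
    refine ⟨k1.trans h1, fun b hb => (h2 b hb).mono k2, ?_⟩
    have : r.stem \ p.stem = (r.stem \ q.stem) ∪ (q.stem \ p.stem) := by
      ext i
      have := @k1 i
      have := @h1 i
      simp only [Finset.mem_union, Finset.mem_sdiff]
      tauto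
    rw [this]
    exact (h3.mono k2).union k3

/-! ### Names for reals and the forcing relation -/

/-- A real is an element of the Cantor space `2^ω`. -/
abbrev Real2 : Type := ℕ → Bool

/-- A (nice) `P`-name for an element of `2^ω`: a set of pairs `(a, n)`. Its value under a
generic filter `H` is the characteristic function of `{n | ∃ a ∈ H, (a, n) ∈ x}`. Every element of
`2^ω` in a generic extension by `P` is the value of such a name. -/
abbrev RealName (P : Type*) : Type _ := Set (P × ℕ)

/-- `q ⊩ x(n) = i`. -/
def ForcesBit {P : Type*} [Preorder P] (q : P) (x : RealName P) (n : ℕ) : Bool → Prop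
  | true => ∀ r ≤ q, ∃ r' ≤ r, ∃ a, (a, n) ∈ x ∧ r' ≤ a
  | false => ∀ r ≤ q, ¬ ∀ r' ≤ r, ∃ r'' ≤ r', ∃ a, (a, n) ∈ x ∧ r'' ≤ a

/-- `q ⊩ x = y` for a ground-model real `y`. -/
def ForcesEq {P : Type*} [Preorder P] (q : P) (x : RealName P) (y : Real2) : Prop :=
  ∀ n, ForcesBit q x n (y n)

/-- `p ⊩ x ∉ V`: no extension of `p` forces `x` to be equal to a ground-model real. -/
def ForcesNew {P : Type*} [Preorder P] (p : P) (x : RealName P) : Prop :=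
  ∀ y : Real2, ∀ q ≤ p, ¬ ForcesEq q x y

/-- `q ⊩ σ ⊂ x`: the finite sequence `σ` is forced to be an initial segment of `x`. -/
def ForcesSegment {P : Type*} [Preorder P] (q : P) (x : RealName P) (σ : List Bool) : Prop :=
  ∀ (i : ℕ) (h : i < σ.length), ForcesBit q x i σ[i]

/-- The initial segment of length `n` of a real. -/
def restrict (y : Real2) (n : ℕ) : List Bool := List.ofFn fun i : Fin n => y i

/-- `q ⊩ x ∈ F`, for a closed subset `F` of `2^ω` in the ground model. In the extension, `F` is
interpreted as the closed set with the same tree of initial segments: it is forced that every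
initial segment of `x` is an initial segment of some ground-model element of `F`. -/
def ForcesMemClosed {P : Type*} [Preorder P] (q : P) (x : RealName P) (F : Set Real2) : Prop :=
  ∀ n, ∀ r ≤ q, ∃ r' ≤ r, ∃ y ∈ F, ForcesSegment r' x (restrict y n)

/-- `σ = x_q`: `σ` is the maximal initial segment of `x` decided by `q`. -/
def IsMaxDecided {P : Type*} [Preorder P] (q : P) (x : RealName P) (σ : List Bool) : Prop :=
  ForcesSegment q x σ ∧ ∀ τ, ForcesSegment q x τ → τ <+: σ

/-- `T_p(x) = {x_q : q ≤ p}`. -/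
def nameTree {P : Type*} [Preorder P] (p : P) (x : RealName P) : Set (List Bool) :=
  {σ | ∃ q ≤ p, IsMaxDecided q x σ}

/-- `[T]`: the branches of the tree generated by `T`, the reals all of whose initial segments are
initial segments of elements of `T`. -/
def body (T : Set (List Bool)) : Set Real2 := {y | ∀ n, ∃ σ ∈ T, restrict y n <+: σ}

/-! ### Graphs on `2^ω` -/

/-- `G` is a (relatively) closed subset of `2^ω × 2^ω` minus the diagonal, and every vertex has
at most countably many neighbours. -/
structure IsClosedLocallyCountable (G : SimpleGraph Real2) : Prop where
  closed : IsClosed {e : {e : Real2 × Real2 // e.1 ≠ e.2} | G.Adj e.1.1 e.1.2}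
  countable : ∀ y, {z | G.Adj y z}.Countable

end MatetForcing

/-!
Let `x` be a name for a new real below `p = (s, A)`. The proof attaches to each stem `t` a *guiding
real* `guide t`, the real that pure extensions of `t` decide `x` to be, and builds a fusion whose
guiding reals are pairwise nonadjacent and determine the body of the name tree.

*Guiding reals.* A condensation `B` of `A` captures all decisions of bits of `x`
(`exists_captures`). Let `U` be an idempotent ultrafilter concentrating on the finite unions of
elements of `B` (`exists_isUnionUltrafilter`). By a Hindman type argument each bit of `x` is decided
in the same way at `t ∪ u` for `U`-almost all `u` (`eventually_decidedAt_guide`); this defines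
`guide t`, and `guide (t ∪ u)` converges to `guide t` along `U` (`tendsto_guide`). Newness of `x`
means that `guide (t ∪ u)` is not constant along `U` (`eventually_guide_ne`), and then a perfect set
argument shows that `guide (t ∪ u)` avoids any given countable closed set for almost all `u`
(`eventually_guide_notMem`). This applies to the set consisting of a real and its neighbours, which
is closed and countable as `G` is closed and locally countable.

*Avoiding edges.* Two stems `t`, `t'` with the same guiding real may be such that `guide (t ∪ u)`
and `guide (t' ∪ u)` are adjacent for almost all `u`; then they are called linked. No choice of
later blocks repairs this, so linked pairs must not arise. If `t` and `t' ∪ w` are linked, then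
`guide (t' ∪ w)` is equal or adjacent to `guide t`, as `G` is closed; for almost all `w` this is not
the case. If `t ∪ w` and `t' ∪ w` are linked for almost all `w`, then `t` and `t'` are linked, as `U`
is idempotent. Hence the property that the stems in a finite set `S` are pairwise unlinked with
nonadjacent guiding reals passes to `S ∪ {t ∪ w : t ∈ S}` for almost all `w`
(`Unlinked.eventually`).

*Fusion.* Choose blocks `a n` in this way, such that moreover the guiding reals of the stems
generated by `a 0, …, a (n - 1)` change only beyond a bound `k n` when later blocks are added, where
`k n` is so large that no edge joins the `k n`-neighbourhoods of distinct guiding reals of these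
stems (`exists_separating_fusion`). The body of the name tree is the closure of the guiding reals.
Two distinct elements of the body are distinguished at some finite stage, where they lie in two of
these neighbourhoods, so they are not adjacent (`exists_fusion_isIndepSet_body`).

If `p` does not force `x` to be new, then some extension forces `x` to be a
ground-model real `y`, and the set `{y}` is as required.
-/

namespace MatetForcing

open Filter Topology

/-! ### Block sets and condensations -/

theorem Below.trans {a b c : Finset ℕ} (hab : Below a b) (hb : b.Nonempty) (hbc : Below b c) :
    Below a c := by
  obtain ⟨k, hk⟩ := hb
  exact fun i hi j hj => (hab i hi k hk).trans (hbc k hk j hj)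

theorem Below.disjoint {a b : Finset ℕ} (h : Below a b) : Disjoint a b :=
  Finset.disjoint_left.2 fun i hi hi' => lt_irrefl _ (h i hi i hi')

theorem Below.union_sdiff {a b : Finset ℕ} (h : Below a b) : (a ∪ b) \ a = b := by
  rw [Finset.union_sdiff_left, Finset.sdiff_eq_self_of_disjoint h.disjoint.symm]

theorem below_of_le {t b : Finset ℕ} (h : ∀ j ∈ b, t.sup id + 1 ≤ j) : Below t b :=
  fun _ hi j hj => lt_of_le_of_lt (Finset.le_sup (f := id) hi) (h j hj)

theorem below_range_iff {m : ℕ} {b : Finset ℕ} :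
    Below (Finset.range m) b ↔ ∀ j ∈ b, m ≤ j := by
  constructor
  · intro h j hj
    by_contra! hlt
    exact lt_irrefl _ (h j (Finset.mem_range.2 hlt) j hj)
  · exact fun h i hi j hj => (Finset.mem_range.1 hi).trans_le (h j hj)

theorem condenses_of_subset {A B : Set (Finset ℕ)} (h : B ⊆ A) : Condenses B A :=
  fun _ hb => IsFinUnion.of_mem (h hb)

theorem Condenses.trans {A B C : Set (Finset ℕ)} (h : Condenses C B) (h' : Condenses B A) :
    Condenses C A :=
  fun c hc => (h c hc).mono h'

theorem past_subset (A : Set (Finset ℕ)) (t : Finset ℕ) : past A t ⊆ A := fun _ h => h.1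

theorem Condenses.past {A B : Set (Finset ℕ)} (h : Condenses B A) (t : Finset ℕ) :
    Condenses (past B t) (past A t) := by
  rintro b ⟨hb, htb⟩
  obtain ⟨F, hF, rfl⟩ := h b hb
  refine ⟨F, fun f hf => ⟨hF hf, fun i hi j hj => htb i hi j ?_⟩, rfl⟩
  exact Finset.mem_biUnion.2 ⟨f, hf, hj⟩

theorem IsFinUnion.below {A : Set (Finset ℕ)} {t b : Finset ℕ} (h : ∀ a ∈ A, Below t a)
    (hb : IsFinUnion A b) : Below t b := by
  obtain ⟨F, hF, rfl⟩ := hb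
  intro i hi j hj
  obtain ⟨f, hf, hjf⟩ := Finset.mem_biUnion.1 hj
  exact h f (hF hf) i hi j hjf

theorem IsBlockSet.mono {A B : Set (Finset ℕ)} (hA : IsBlockSet A) (hBA : B ⊆ A)
    (hB : B.Infinite) : IsBlockSet B :=
  ⟨hB, fun a ha => hA.nonempty a (hBA ha), fun a ha b hb => hA.blocks a (hBA ha) b (hBA hb)⟩

/-- Distinct blocks have distinct minima, and a block that is not above `t` has its minimum at most
`max t`. -/
theorem IsBlockSet.finite_not_below {A : Set (Finset ℕ)} (hA : IsBlockSet A) (t : Finset ℕ) :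
    {a ∈ A | ¬ Below t a}.Finite := by
  classical
  let f : Finset ℕ → ℕ := fun a => if h : a.Nonempty then a.min' h else 0
  have hf : ∀ a ∈ A, f a ∈ a := fun a ha => by
    simp only [f, dif_pos (hA.nonempty a ha)]
    exact Finset.min'_mem _ _
  refine Set.Finite.of_finite_image (f := f) ((Set.finite_Iio (t.sup id + 1)).subset ?_) ?_
  · rintro _ ⟨a, ⟨ha, hta⟩, rfl⟩
    by_contra hlt
    refine hta (below_of_le fun j hj => (not_lt.1 hlt).trans ?_)
    simp only [f, dif_pos (hA.nonempty a ha)]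
    exact Finset.min'_le _ _ hj
  · rintro a ⟨ha, -⟩ b ⟨hb, -⟩ hab
    by_contra hne
    rcases hA.blocks a ha b hb hne with h | h
    · exact (h _ (hf a ha) _ (hf b hb)).ne hab
    · exact (h _ (hf b hb) _ (hf a ha)).ne hab.symm

theorem IsBlockSet.past {A : Set (Finset ℕ)} (hA : IsBlockSet A) (t : Finset ℕ) :
    IsBlockSet (past A t) := by
  refine hA.mono (past_subset A t) fun hfin => hA.infinite ?_
  refine (hfin.union (hA.finite_not_below t)).subset fun a ha => ?_
  by_cases h : Below t a
  exacts [Or.inl ⟨ha, h⟩, Or.inr ⟨ha, h⟩]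

theorem IsBlockSet.exists_below {A : Set (Finset ℕ)} (hA : IsBlockSet A) (t : Finset ℕ) :
    ∃ a ∈ A, Below t a :=
  (hA.past t).infinite.nonempty

theorem isBlockSet_range {a : ℕ → Finset ℕ} (hne : ∀ n, (a n).Nonempty)
    (hlt : ∀ i j, i < j → Below (a i) (a j)) : IsBlockSet (Set.range a) := by
  refine ⟨Set.infinite_range_of_injective fun i j hij => ?_, ?_, ?_⟩
  · by_contra hne'
    rcases lt_or_gt_of_ne hne' with h | h
    · obtain ⟨k, hk⟩ := hne i
      exact lt_irrefl _ (hlt i j h k hk k (hij ▸ hk))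
    · obtain ⟨k, hk⟩ := hne j
      exact lt_irrefl _ (hlt j i h k hk k (hij ▸ hk))
  · rintro _ ⟨n, rfl⟩
    exact hne n
  · rintro _ ⟨i, rfl⟩ _ ⟨j, rfl⟩ hij
    rcases lt_trichotomy i j with h | h | h
    exacts [Or.inl (hlt i j h), absurd (congrArg a h) hij, Or.inr (hlt j i h)]

/-- The condensation order on block sets is σ-closed modulo initial segments: a descending sequence
has a lower bound up to finitely many blocks. -/
theorem exists_condenses_past_of_descending (A : ℕ → Set (Finset ℕ))
    (hA : ∀ j, IsBlockSet (A j)) (hdesc : ∀ j, Condenses (A (j + 1)) (A j)) :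
    ∃ B, IsBlockSet B ∧ Condenses B (A 0) ∧
      ∀ j, ∃ m, Condenses (past B (Finset.range m)) (A j) := by
  have hanti : ∀ i j, i ≤ j → Condenses (A j) (A i) := by
    intro i j hij
    induction j, hij using Nat.le_induction with
    | base => exact condenses_of_subset subset_rfl
    | succ j _ ih => exact (hdesc j).trans ih
  choose nxt hmem hbel using fun j t => (hA j).exists_below t
  let b : ℕ → Finset ℕ := fun n => Nat.rec (nxt 0 ∅) (fun n c => nxt (n + 1) c) n
  have hb : ∀ n, b n ∈ A n := by
    rintro (_ | n)
    exacts [hmem 0 ∅, hmem (n + 1) (b n)]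
  have hne : ∀ n, (b n).Nonempty := fun n => (hA n).nonempty _ (hb n)
  have hlt : ∀ i j, i < j → Below (b i) (b j) := by
    intro i j hij
    induction j, hij using Nat.le_induction with
    | base => exact hbel (i + 1) (b i)
    | succ j _ ih => exact ih.trans (hne j) (hbel (j + 1) (b j))
  refine ⟨Set.range b, isBlockSet_range hne hlt, ?_, fun j => ⟨(b j).sup id + 1, ?_⟩⟩
  · rintro _ ⟨n, rfl⟩
    exact hanti 0 n n.zero_le _ (hb n)
  · rintro _ ⟨⟨n, rfl⟩, hn⟩
    rcases lt_or_ge n j with h | h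
    · obtain ⟨k, hk⟩ := hne n
      obtain ⟨l, hl⟩ := hne j
      have h1 := hlt n j h k hk l hl
      have h2 := below_of_le (below_range_iff.1 hn) l hl k hk
      exact absurd h1 h2.not_gt
    · exact hanti j n h _ (hb n)

/-! ### Conditions -/

theorem Condition.le_of_stem_eq {q p : Condition} (h : q.stem = p.stem)
    (hc : Condenses q.blocks p.blocks) : q ≤ p :=
  ⟨h ▸ subset_rfl, hc, by simpa [h] using IsFinUnion.empty p.blocks⟩

/-- The condition obtained by removing the blocks of `q` that are not above `s`. -/
def Condition.tail (q : Condition) (s : Finset ℕ) : Condition where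
  stem := q.stem
  blocks := past q.blocks s
  isBlockSet := q.isBlockSet.past s
  stem_below a ha := q.stem_below a ha.1

theorem Condition.tail_le (q : Condition) (s : Finset ℕ) : q.tail s ≤ q :=
  le_of_stem_eq rfl (condenses_of_subset (past_subset _ _))

/-- The condition obtained from `q` by adding `u` to the stem. -/
def Condition.extend (q : Condition) (u : Finset ℕ) : Condition where
  stem := q.stem ∪ u
  blocks := past q.blocks (q.stem ∪ u)
  isBlockSet := q.isBlockSet.past _
  stem_below _ ha := ha.2

theorem Condition.extend_le {q : Condition} {u : Finset ℕ} (hu : IsFinUnion q.blocks u) :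
    q.extend u ≤ q := by
  refine ⟨Finset.subset_union_left, condenses_of_subset (past_subset _ _), ?_⟩
  change IsFinUnion q.blocks ((q.stem ∪ u) \ q.stem)
  rwa [(hu.below q.stem_below).union_sdiff]

/-- Every condition has an extension below which the stem is strictly larger. -/
theorem Condition.exists_le_forall_stem_ne (q : Condition) :
    ∃ r ≤ q, ∀ r' ≤ r, r'.stem ≠ q.stem := by
  obtain ⟨a, ha⟩ := q.isBlockSet.infinite.nonempty
  refine ⟨q.extend a, extend_le (.of_mem ha), fun r' hr' heq => ?_⟩
  obtain ⟨k, hk⟩ := q.isBlockSet.nonempty a ha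
  have : k ∈ q.stem := heq ▸ hr'.1 (Finset.mem_union_right _ hk)
  exact lt_irrefl _ (q.stem_below a ha k this k hk)

/-! ### Forced bits -/

section ForcesBit

variable {P : Type*} [Preorder P] {x : RealName P} {p q : P} {n : ℕ} {i j : Bool}

theorem ForcesBit.mono (h : ForcesBit p x n i) (hqp : q ≤ p) : ForcesBit q x n i := by
  cases i
  exacts [fun r hr => h r (hr.trans hqp), fun r hr => h r (hr.trans hqp)]

theorem ForcesBit.unique (hi : ForcesBit p x n i) (hj : ForcesBit p x n j) : i = j := by
  cases i <;> cases j
  exacts [rfl, absurd hj (hi p le_rfl), absurd hi (hj p le_rfl), rfl]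

variable (x) in
theorem exists_forcesBit (p : P) (n : ℕ) : ∃ q ≤ p, ∃ i, ForcesBit q x n i := by
  by_cases h : ForcesBit p x n true
  · exact ⟨p, le_rfl, true, h⟩
  · simp only [ForcesBit, not_forall] at h
    obtain ⟨q, hq, h⟩ := h
    refine ⟨q, hq, false, fun r hr hdense => h ?_⟩
    obtain ⟨r', hr', a, ha, hle⟩ := hdense r le_rfl
    exact ⟨r', hr'.trans hr, a, ha, hle⟩

/-- A condition forces a bit as soon as no extension forces the opposite bit. -/
theorem forcesBit_of_forall (h : ∀ q ≤ p, ∀ j, ForcesBit q x n j → j = i) :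
    ForcesBit p x n i := by
  have hd : ∀ q ≤ p, ∃ r ≤ q, ForcesBit r x n i := fun q hq => by
    obtain ⟨r, hr, j, hj⟩ := exists_forcesBit x q n
    exact ⟨r, hr, h r (hr.trans hq) j hj ▸ hj⟩
  cases i
  · intro q hq hdense
    obtain ⟨r, hr, hrn⟩ := hd q hq
    exact hrn r le_rfl fun r' hr' => hdense r' (hr'.trans hr)
  · intro q hq
    obtain ⟨r, hr, hrn⟩ := hd q hq
    obtain ⟨r', hr', a, ha, hle⟩ := hrn r le_rfl
    exact ⟨r', hr'.trans hr, a, ha, hle⟩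

end ForcesBit

/-- `B` captures all decisions of bits of `x`: whatever is decided by a stem together with some
condensation of `B` is decided by that stem together with a final segment of `B`. -/
def Captures (x : RealName Condition) (B : Set (Finset ℕ)) : Prop :=
  ∀ (q : Condition) (n : ℕ) (i : Bool), Condenses q.blocks B → ForcesBit q x n i →
    ∃ r : Condition, r.stem = q.stem ∧ (∃ m, r.blocks = past B (Finset.range m)) ∧
      ForcesBit r x n i

/-- Since there are only countably many stems and bits, each of them can be taken care of along a
descending sequence of condensations of `A`, of which `B` is a lower bound. -/
theorem exists_captures (x : RealName Condition) {A : Set (Finset ℕ)} (hA : IsBlockSet A) :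
    ∃ B, IsBlockSet B ∧ Condenses B A ∧ Captures x B := by
  have step : ∀ (e : Finset ℕ × ℕ × Bool) (A : {A // IsBlockSet A}),
      ∃ A' : {A // IsBlockSet A}, Condenses A'.1 A.1 ∧
        ∀ q : Condition, q.stem = e.1 → Condenses q.blocks A.1 → ForcesBit q x e.2.1 e.2.2 →
          ∃ r : Condition, r.stem = e.1 ∧ r.blocks = A'.1 ∧ ForcesBit r x e.2.1 e.2.2 := by
    intro e A
    by_cases h : ∃ q : Condition, q.stem = e.1 ∧ Condenses q.blocks A.1 ∧
        ForcesBit q x e.2.1 e.2.2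
    · obtain ⟨q, hq, hqA, hqx⟩ := h
      exact ⟨⟨q.blocks, q.isBlockSet⟩, hqA, fun _ _ _ _ => ⟨q, hq, rfl, hqx⟩⟩
    · exact ⟨A, condenses_of_subset subset_rfl, fun q h1 h2 h3 => absurd ⟨q, h1, h2, h3⟩ h⟩
  obtain ⟨e, he⟩ := exists_surjective_nat (Finset ℕ × ℕ × Bool)
  choose nxt hcond hnxt using step
  let D : ℕ → {A // IsBlockSet A} := fun n => Nat.rec ⟨A, hA⟩ (fun n B => nxt (e n) B) n
  obtain ⟨B, hB, hB0, hBj⟩ := exists_condenses_past_of_descending (fun n => (D n).1)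
    (fun n => (D n).2) (fun n => hcond (e n) (D n))
  refine ⟨B, hB, hB0, fun q n i hqB hqx => ?_⟩
  -- The decision made by `q` is the requirement treated at stage `j`, and deleting finitely many
  -- blocks of `q` yields a condensation of `D j`.
  obtain ⟨j, hj⟩ := he (q.stem, n, i)
  obtain ⟨m₀, hm₀⟩ := hBj j
  obtain ⟨m₁, hm₁⟩ := hBj (j + 1)
  obtain ⟨r, hr, hrD, hrx⟩ := hnxt (e j) (D j) (q.tail (Finset.range m₀)) (by rw [hj]; rfl)
    ((hqB.past _).trans hm₀) (by rw [hj]; exact hqx.mono (q.tail_le _))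
  rw [hj] at hr hrx
  have hsub : past B (Finset.range (max m₁ (q.stem.sup id + 1))) ⊆ past B (Finset.range m₁) :=
    fun b hb => ⟨hb.1, below_range_iff.2 fun k hk =>
      (le_max_left _ _).trans (below_range_iff.1 hb.2 k hk)⟩
  refine ⟨⟨q.stem, past B (Finset.range (max m₁ (q.stem.sup id + 1))), hB.past _, fun b hb =>
    below_of_le fun k hk => (le_max_right _ _).trans (below_range_iff.1 hb.2 k hk)⟩, rfl,
    ⟨_, rfl⟩, hrx.mono (Condition.le_of_stem_eq hr.symm ?_)⟩
  rw [hrD]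
  exact (condenses_of_subset hsub).trans hm₁

/-! ### Idempotent ultrafilters of finite unions -/

/-- `U` is an ultrafilter on the finite subsets of `ω` that is idempotent with respect to unions and
concentrates on the nonempty finite unions of elements of `B` above any given bound. -/
structure IsUnionUltrafilter (B : Set (Finset ℕ)) (U : Ultrafilter (Finset ℕ)) : Prop where
  idem : ∀ P : Finset ℕ → Prop, (∀ᶠ w in U, P w) ↔ ∀ᶠ u in U, ∀ᶠ v in U, P (u ∪ v)
  concentrates : ∀ m, ∀ᶠ w in U, IsFinUnion B w ∧ w.Nonempty ∧ ∀ j ∈ w, m ≤ j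

attribute [local instance] Ultrafilter.semigroup in
/-- The ultrafilters concentrating on the finite unions of `B` form a closed subsemigroup, so that
there is an idempotent one among them. -/
theorem exists_isUnionUltrafilter {B : Set (Finset ℕ)} (hB : IsBlockSet B) :
    ∃ U, IsUnionUltrafilter B U := by
  let : Semigroup (Finset ℕ) := { mul := (· ∪ ·), mul_assoc := Finset.union_assoc }
  let E : ℕ → Set (Finset ℕ) := fun m => {w | IsFinUnion B w ∧ w.Nonempty ∧ ∀ j ∈ w, m ≤ j}
  have hE : ∀ m n, m ≤ n → E n ⊆ E m := fun m n hmn w hw =>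
    ⟨hw.1, hw.2.1, fun j hj => hmn.trans (hw.2.2 j hj)⟩
  have hEne : ∀ m, (E m).Nonempty := fun m => by
    obtain ⟨a, ha, hma⟩ := hB.exists_below (Finset.range m)
    exact ⟨a, .of_mem ha, hB.nonempty a ha, below_range_iff.1 hma⟩
  let T : Set (Ultrafilter (Finset ℕ)) := {U | ∀ m, E m ∈ U}
  have hTne : T.Nonempty := by
    have : (⨅ m, 𝓟 (E m)).NeBot := by
      refine iInf_neBot_of_directed ?_ fun m => principal_neBot_iff.2 (hEne m)
      exact directed_of_isDirected_le fun m n hmn => principal_mono.2 (hE m n hmn)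
    refine ⟨Ultrafilter.of (⨅ m, 𝓟 (E m)), fun m => ?_⟩
    exact Ultrafilter.of_le _ (mem_iInf_of_mem m (mem_principal_self _))
  have hTcl : IsClosed T := by
    have : T = ⋂ m, {U : Ultrafilter (Finset ℕ) | E m ∈ U} := by
      ext U
      simp [T]
    rw [this]
    exact isClosed_iInter fun m => ultrafilter_isClosed_basic _
  obtain ⟨U, hUT, hU⟩ := exists_idempotent_in_compact_subsemigroup
    (fun V => Ultrafilter.continuous_mul_left V) T hTne hTcl.isCompact (fun U hU V hV m => by
      change ∀ᶠ w in (↑(U * V) : Filter (Finset ℕ)), w ∈ E m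
      rw [Ultrafilter.eventually_mul]
      filter_upwards [hU m] with u hu
      filter_upwards [hV m] with v hv
      exact ⟨hu.1.union hv.1, hu.2.1.mono Finset.subset_union_left, fun j hj =>
        (Finset.mem_union.1 hj).elim (hu.2.2 j) (hv.2.2 j)⟩)
  refine ⟨U, fun P => ?_, hUT⟩
  conv_lhs => rw [← hU]
  exact Ultrafilter.eventually_mul U U P

theorem IsUnionUltrafilter.eventually_below {B : Set (Finset ℕ)} {U : Ultrafilter (Finset ℕ)}
    (hU : IsUnionUltrafilter B U) (t : Finset ℕ) : ∀ᶠ w in U, Below t w :=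
  (hU.concentrates _).mono fun _ hw => below_of_le hw.2.2

/-! ### Stems generated by a sequence of blocks -/

/-- `stems s a n` consists of the sets `s ∪ ⋃ i ∈ I, a i` with `I ⊆ {0, …, n - 1}`. -/
def stems (s : Finset ℕ) (a : ℕ → Finset ℕ) : ℕ → Finset (Finset ℕ)
  | 0 => {s}
  | n + 1 => stems s a n ∪ (stems s a n).image (· ∪ a n)

section Stems

variable {s : Finset ℕ} {a : ℕ → Finset ℕ}

theorem mem_stems_succ {n : ℕ} {t : Finset ℕ} :
    t ∈ stems s a (n + 1) ↔ t ∈ stems s a n ∨ ∃ t' ∈ stems s a n, t' ∪ a n = t := by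
  simp [stems]

theorem stems_mono : Monotone (stems s a) :=
  monotone_nat_of_le_succ fun _ => Finset.subset_union_left

theorem self_mem_stems (n : ℕ) : s ∈ stems s a n :=
  stems_mono n.zero_le (by simp [stems])

/-- Any relation that holds along one-step extensions `t ∪ a n` of stems holds along all
extensions. -/
theorem union_biUnion_mem_stems {m : ℕ} {R : Finset ℕ → Finset ℕ → Prop}
    (hrefl : ∀ t, R t t) (htrans : ∀ t u v, R t u → R u v → R t v)
    (hR : ∀ n, m ≤ n → ∀ t ∈ stems s a n, R t (t ∪ a n)) {t : Finset ℕ} (ht : t ∈ stems s a m)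
    {n : ℕ} (hmn : m ≤ n) {J : Finset ℕ} (hJ : J ⊆ Finset.Ico m n) :
    t ∪ J.biUnion a ∈ stems s a n ∧ R t (t ∪ J.biUnion a) := by
  induction n, hmn using Nat.le_induction generalizing J with
  | base =>
    obtain rfl : J = ∅ := by simpa using hJ
    simpa using ⟨ht, hrefl t⟩
  | succ n hmn ih =>
    have hsub : J.erase n ⊆ Finset.Ico m n := fun j hj => by
      have := Finset.mem_Ico.1 (hJ (Finset.mem_of_mem_erase hj))
      have := Finset.ne_of_mem_erase hj
      exact Finset.mem_Ico.2 (by omega)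
    obtain ⟨h1, h2⟩ := ih hsub
    by_cases hn : n ∈ J
    · have heq : t ∪ J.biUnion a = (t ∪ (J.erase n).biUnion a) ∪ a n := by
        rw [← Finset.insert_erase hn, Finset.biUnion_insert, Finset.union_comm (a n),
          Finset.erase_insert (Finset.notMem_erase n J), Finset.union_assoc]
      rw [heq]
      exact ⟨mem_stems_succ.2 (Or.inr ⟨_, h1, rfl⟩), htrans _ _ _ h2 (hR n hmn _ h1)⟩
    · rw [Finset.erase_eq_of_notMem hn] at h1 h2
      exact ⟨mem_stems_succ.2 (Or.inl h1), h2⟩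

theorem exists_biUnion_of_isFinUnion {m : ℕ} {b : Finset ℕ}
    (hb : IsFinUnion (a '' Set.Ici m) b) :
    ∃ n, m ≤ n ∧ ∃ J ⊆ Finset.Ico m n, b = J.biUnion a := by
  obtain ⟨F, hF, rfl⟩ := hb
  obtain ⟨J, hJ, rfl⟩ := Finset.subset_set_image_iff.1 hF
  refine ⟨m + J.sup id + 1, by omega, J, fun j hj => ?_, by rw [Finset.image_biUnion]; rfl⟩
  have h1 : m ≤ j := hJ hj
  have h2 : j ≤ J.sup id := Finset.le_sup (f := id) hj
  exact Finset.mem_Ico.2 (by omega)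

theorem below_of_lt (hbel : ∀ n, ∀ t ∈ stems s a n, Below t (a n)) {i j : ℕ} (hij : i < j) :
    Below (a i) (a j) := fun k hk l hl =>
  hbel j _ (stems_mono hij (mem_stems_succ.2 (Or.inr ⟨s, self_mem_stems i, rfl⟩))) k
    (Finset.mem_union_right _ hk) l hl

theorem isBlockSet_image_Ici (hne : ∀ n, (a n).Nonempty)
    (hbel : ∀ n, ∀ t ∈ stems s a n, Below t (a n)) (m : ℕ) : IsBlockSet (a '' Set.Ici m) := by
  have : a '' Set.Ici m = Set.range fun n => a (m + n) := by
    ext b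
    constructor
    · rintro ⟨n, hn, rfl⟩
      exact ⟨n - m, congrArg a (Nat.add_sub_cancel' hn)⟩
    · rintro ⟨n, rfl⟩
      exact ⟨m + n, Nat.le_add_right m n, rfl⟩
  rw [this]
  exact isBlockSet_range (fun _ => hne _) fun _ _ h => below_of_lt hbel (by omega)

/-- The condition `(t, {a n : n ≥ m})`, for a stem `t` generated by `a 0, …, a (m - 1)`. -/
def seqCondition (hne : ∀ n, (a n).Nonempty) (hbel : ∀ n, ∀ t ∈ stems s a n, Below t (a n))
    (m : ℕ) (t : Finset ℕ) (ht : t ∈ stems s a m) : Condition where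
  stem := t
  blocks := a '' Set.Ici m
  isBlockSet := isBlockSet_image_Ici hne hbel m
  stem_below := by
    rintro _ ⟨n, hn, rfl⟩
    exact hbel n t (stems_mono hn ht)

theorem exists_stem_eq_of_le_seqCondition {hne : ∀ n, (a n).Nonempty}
    {hbel : ∀ n, ∀ t ∈ stems s a n, Below t (a n)} {m : ℕ} {t : Finset ℕ} {ht : t ∈ stems s a m}
    {r : Condition} (hr : r ≤ seqCondition hne hbel m t ht) :
    ∃ n, m ≤ n ∧ ∃ J ⊆ Finset.Ico m n, r.stem = t ∪ J.biUnion a := by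
  obtain ⟨n, hmn, J, hJ, hJa⟩ := exists_biUnion_of_isFinUnion hr.2.2
  exact ⟨n, hmn, J, hJ, hJa ▸ (Finset.union_sdiff_of_subset hr.1).symm⟩

theorem seqCondition_le {hne : ∀ n, (a n).Nonempty}
    {hbel : ∀ n, ∀ t ∈ stems s a n, Below t (a n)} {m : ℕ} {t : Finset ℕ}
    (ht : t ∈ stems s a m) :
    seqCondition hne hbel m t ht ≤ seqCondition hne hbel 0 s (self_mem_stems 0) := by
  have h : ∀ n, ∀ t ∈ stems s a n, s ⊆ t ∧ IsFinUnion (a '' Set.Ici 0) (t \ s) := by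
    intro n
    induction n with
    | zero => simpa [stems] using IsFinUnion.empty _
    | succ n ih =>
      intro t ht
      rcases mem_stems_succ.1 ht with ht | ⟨u, hu, rfl⟩
      · exact ih t ht
      · obtain ⟨h1, h2⟩ := ih u hu
        refine ⟨h1.trans Finset.subset_union_left, ?_⟩
        have hdis := (hbel n s (self_mem_stems n)).disjoint.symm
        rw [Finset.union_sdiff_distrib, Finset.sdiff_eq_self_of_disjoint hdis]
        exact h2.union (.of_mem ⟨n, n.zero_le, rfl⟩)
  exact ⟨(h m t ht).1, condenses_of_subset (Set.image_mono fun _ _ => Nat.zero_le _),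
    (h m t ht).2⟩

/-- Below `seqCondition hne hbel 0 s _`, discarding finitely many blocks leads below the condition
`seqCondition hne hbel m t _`, where `t` is the stem. -/
theorem tail_le_seqCondition {hne : ∀ n, (a n).Nonempty}
    {hbel : ∀ n, ∀ t ∈ stems s a n, Below t (a n)} {r : Condition}
    (hr : r ≤ seqCondition hne hbel 0 s (self_mem_stems 0)) {m : ℕ}
    (ht : r.stem ∈ stems s a m) : r.tail (a m) ≤ seqCondition hne hbel m r.stem ht := by
  refine Condition.le_of_stem_eq rfl ((hr.2.1.past (a m)).trans (condenses_of_subset ?_))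
  rintro _ ⟨⟨n, -, rfl⟩, hn⟩
  refine ⟨n, Set.mem_Ici.2 (not_lt.1 fun hnm => ?_), rfl⟩
  obtain ⟨i, hi⟩ := hne m
  obtain ⟨k, hk⟩ := hne n
  exact absurd (below_of_lt hbel hnm k hk i hi) (hn i hi k hk).not_gt

end Stems

/-! ### Fusions along a union ultrafilter -/

/-- Dependent choice along a union ultrafilter: if `U`-almost every `w` leads from a good set of
stems `S` to a good set of stems `S ∪ {t ∪ w : t ∈ S}`, then a whole sequence of blocks can be
chosen. The number `k` is a bound that may depend on the stage. -/
theorem IsUnionUltrafilter.exists_fusion {B : Set (Finset ℕ)} {U : Ultrafilter (Finset ℕ)}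
    (hU : IsUnionUltrafilter B U) {Inv : ℕ → Finset (Finset ℕ) → Prop}
    {Step : ℕ → Finset ℕ → Finset ℕ → Prop} {s : Finset ℕ} {k₀ : ℕ} (h₀ : Inv k₀ {s})
    (hs : ∀ k S, Inv k S → ∀ᶠ w in U, (∀ t ∈ S, Step k t w) ∧
      ∃ k', k < k' ∧ Inv k' (S ∪ S.image (· ∪ w))) :
    ∃ (a : ℕ → Finset ℕ) (k : ℕ → ℕ), StrictMono k ∧ (∀ n, Inv (k n) (stems s a n)) ∧
      (∀ n, ∀ t ∈ stems s a n, Step (k n) t (a n)) ∧ (∀ n, IsFinUnion B (a n)) ∧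
      (∀ n, (a n).Nonempty) ∧ ∀ n, ∀ t ∈ stems s a n, Below t (a n) := by
  have step : ∀ σ : {σ : ℕ × Finset (Finset ℕ) // Inv σ.1 σ.2},
      ∃ (w : Finset ℕ) (k' : ℕ), σ.1.1 < k' ∧ Inv k' (σ.1.2 ∪ σ.1.2.image (· ∪ w)) ∧
        (∀ t ∈ σ.1.2, Step σ.1.1 t w) ∧ IsFinUnion B w ∧ w.Nonempty ∧
        ∀ t ∈ σ.1.2, Below t w := by
    rintro ⟨⟨k, S⟩, hσ⟩
    have hbel : ∀ᶠ w in U, ∀ t ∈ S, Below t w :=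
      (eventually_all_finset S).2 fun t _ => hU.eventually_below t
    obtain ⟨w, ⟨h1, k', h2, h3⟩, h4, h5⟩ :=
      ((hs k S hσ).and ((hU.concentrates 0).and hbel)).exists
    exact ⟨w, k', h2, h3, h1, h4.1, h4.2.1, h5⟩
  choose w k' hlt hinv hstep hfu hne hbel using step
  let σ : ℕ → {σ : ℕ × Finset (Finset ℕ) // Inv σ.1 σ.2} := fun n =>
    Nat.rec ⟨(k₀, {s}), h₀⟩ (fun _ τ => ⟨(k' τ, _), hinv τ⟩) n
  have hσ : ∀ n, (σ n).1.2 = stems s (fun n => w (σ n)) n := by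
    intro n
    induction n with
    | zero => rfl
    | succ n ih =>
      rw [stems, ← ih]
  refine ⟨fun n => w (σ n), fun n => (σ n).1.1, strictMono_nat_of_lt_succ fun n => hlt (σ n),
    fun n => hσ n ▸ (σ n).2, fun n => hσ n ▸ hstep (σ n), fun n => hfu _, fun n => hne _,
    fun n => hσ n ▸ hbel (σ n)⟩

/-- The form of Hindman's theorem used for pure decision: a property that holds for `t ∪ w` for
`U`-almost all `w` holds for all proper extensions of the stem `t` below some condition. -/
theorem IsUnionUltrafilter.exists_condition {B : Set (Finset ℕ)} {U : Ultrafilter (Finset ℕ)}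
    (hU : IsUnionUltrafilter B U) {P : Finset ℕ → Prop} {t : Finset ℕ}
    (h : ∀ᶠ w in U, P (t ∪ w)) :
    ∃ q : Condition, q.stem = t ∧ Condenses q.blocks B ∧
      ∀ r ≤ q, r.stem ≠ t → P r.stem := by
  obtain ⟨a, -, -, -, hP, hfu, hne, hbel⟩ := hU.exists_fusion (s := t) (k₀ := 0)
    (Inv := fun _ S => ∀ t ∈ S, ∀ᶠ w in U, P (t ∪ w)) (Step := fun _ t w => P (t ∪ w))
    (by simpa using h) (by
      intro k S hS
      have h1 : ∀ᶠ w in U, ∀ t ∈ S, P (t ∪ w) := (eventually_all_finset S).2 hS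
      have h2 : ∀ᶠ w in U, ∀ t ∈ S, ∀ᶠ v in U, P (t ∪ w ∪ v) :=
        (eventually_all_finset S).2 fun t ht => by
          simpa only [Finset.union_assoc] using (hU.idem fun w => P (t ∪ w)).1 (hS t ht)
      filter_upwards [h1, h2] with w hw1 hw2
      refine ⟨hw1, k + 1, k.lt_succ_self, fun t ht => ?_⟩
      rcases Finset.mem_union.1 ht with ht | ht
      · exact hS t ht
      · obtain ⟨t', ht', rfl⟩ := Finset.mem_image.1 ht
        exact hw2 t' ht')
  refine ⟨seqCondition hne hbel 0 t (self_mem_stems 0), rfl, ?_, fun r hr hrt => ?_⟩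
  · rintro _ ⟨n, -, rfl⟩
    exact hfu n
  · obtain ⟨n, hn, J, hJ, hrs⟩ := exists_stem_eq_of_le_seqCondition hr
    have hall : ∀ n, ∀ t' ∈ stems t a n, t' = t ∨ P t' := by
      intro n
      induction n with
      | zero => simp [stems]
      | succ n ih =>
        intro t' ht'
        rcases mem_stems_succ.1 ht' with ht' | ⟨t'', ht'', rfl⟩
        exacts [ih t' ht', Or.inr (hP n t'' ht'')]
    have hmem := (union_biUnion_mem_stems (s := t) (a := a) (R := fun _ _ => True)
      (fun _ => trivial) (fun _ _ _ _ _ => trivial) (fun _ _ _ _ => trivial)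
      (self_mem_stems 0) hn hJ).1
    rw [← hrs] at hmem
    exact (hall n _ hmem).resolve_left hrt

/-! ### Guiding reals -/

/-- Some condition with stem `t` and blocks condensing `B` forces `x(n) = i`. -/
def DecidedAt (x : RealName Condition) (B : Set (Finset ℕ)) (t : Finset ℕ) (n : ℕ)
    (i : Bool) : Prop :=
  ∃ q : Condition, q.stem = t ∧ Condenses q.blocks B ∧ ForcesBit q x n i

open Classical in
/-- The real that `x` is decided to be by pure extensions of the stem `t`: its `n`-th bit is the
value of `x(n)` decided at `t ∪ u` for `U`-almost all `u`. -/
noncomputable def guide (x : RealName Condition) (B : Set (Finset ℕ)) (U : Ultrafilter (Finset ℕ))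
    (t : Finset ℕ) : Real2 :=
  fun n => decide (∀ᶠ u in U, DecidedAt x B (t ∪ u) n true)

section Guide

variable {x : RealName Condition} {B : Set (Finset ℕ)} {U : Ultrafilter (Finset ℕ)}
  {t : Finset ℕ} {n : ℕ} {i j : Bool}

theorem DecidedAt.unique (hB : Captures x B) (hi : DecidedAt x B t n i)
    (hj : DecidedAt x B t n j) : i = j := by
  obtain ⟨q, hqt, hqB, hq⟩ := hi
  obtain ⟨q', hqt', hqB', hq'⟩ := hj
  obtain ⟨r, hrt, ⟨m, hrm⟩, hr⟩ := hB q n i hqB hq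
  obtain ⟨r', hrt', ⟨m', hrm'⟩, hr'⟩ := hB q' n j hqB' hq'
  have h1 : r.tail (Finset.range m') ≤ r' := by
    refine Condition.le_of_stem_eq ?_ (condenses_of_subset ?_)
    · exact hrt.trans (hqt.trans (hqt'.symm.trans hrt'.symm))
    · rw [hrm']
      exact fun b hb => ⟨(hrm ▸ hb.1 : b ∈ past B _).1, hb.2⟩
  exact (hr.mono (r.tail_le _)).unique (hr'.mono h1)

theorem DecidedAt.eventually (hU : IsUnionUltrafilter B U) (hB : Captures x B)
    (h : DecidedAt x B t n i) : ∀ᶠ u in U, DecidedAt x B (t ∪ u) n i := by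
  obtain ⟨q, rfl, hqB, hq⟩ := h
  obtain ⟨r, hrt, ⟨m, hrm⟩, hr⟩ := hB q n i hqB hq
  filter_upwards [hU.concentrates m] with u hu
  have hfu : IsFinUnion r.blocks u := by
    have hsing : Condenses {u} B := by
      rintro _ rfl
      exact hu.1
    rw [hrm]
    exact hsing.past (Finset.range m) u ⟨rfl, below_range_iff.2 hu.2.2⟩
  refine ⟨r.extend u, by rw [← hrt]; rfl, ?_, hr.mono (Condition.extend_le hfu)⟩
  refine condenses_of_subset ((past_subset _ _).trans ?_)
  rw [hrm]
  exact past_subset _ _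

/-- Pure decision. If the bit `n` were undecided at `t ∪ u` for `U`-almost all `u`, some condition
with stem `t` would have no extension deciding it. -/
theorem eventually_decidedAt_guide (x : RealName Condition) (hU : IsUnionUltrafilter B U)
    (t : Finset ℕ) (n : ℕ) : ∀ᶠ u in U, DecidedAt x B (t ∪ u) n (guide x B U t n) := by
  by_cases ht : ∀ᶠ u in U, DecidedAt x B (t ∪ u) n true
  · simp [guide, ht]
  · suffices h : ∀ᶠ u in U, DecidedAt x B (t ∪ u) n false by simpa [guide, ht] using h
    by_contra hf
    rw [← Ultrafilter.eventually_not] at ht hf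
    obtain ⟨q, rfl, hqB, hq⟩ := hU.exists_condition
      (P := fun t => ¬ DecidedAt x B t n true ∧ ¬ DecidedAt x B t n false) (ht.and hf)
    obtain ⟨r, hr, hrne⟩ := q.exists_le_forall_stem_ne
    obtain ⟨r', hr', i, hi⟩ := exists_forcesBit x r n
    have hdec : DecidedAt x B r'.stem n i := ⟨r', rfl, (hr'.trans hr).2.1.trans hqB, hi⟩
    have hnot := hq r' (hr'.trans hr) (hrne r' hr')
    cases i
    exacts [hnot.2 hdec, hnot.1 hdec]

theorem DecidedAt.guide_eq (hU : IsUnionUltrafilter B U) (hB : Captures x B)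
    (h : DecidedAt x B t n i) : guide x B U t n = i := by
  obtain ⟨u, hu1, hu2⟩ :=
    ((eventually_decidedAt_guide x hU t n).and (h.eventually hU hB)).exists
  exact hu1.unique hB hu2

theorem tendsto_guide (hU : IsUnionUltrafilter B U) (hB : Captures x B) (t : Finset ℕ) :
    Tendsto (fun u => guide x B U (t ∪ u)) U (𝓝 (guide x B U t)) := by
  refine tendsto_pi_nhds.2 fun n => ?_
  rw [nhds_discrete, tendsto_pure]
  exact (eventually_decidedAt_guide x hU t n).mono fun u hu => hu.guide_eq hU hB

theorem eventually_guide_eq (hU : IsUnionUltrafilter B U) (hB : Captures x B) (t : Finset ℕ)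
    (k : ℕ) : ∀ᶠ u in U, ∀ j < k, guide x B U (t ∪ u) j = guide x B U t j := by
  have : ∀ᶠ u in U, ∀ j ∈ Finset.range k, guide x B U (t ∪ u) j = guide x B U t j :=
    (eventually_all_finset _).2 fun n _ =>
      (eventually_decidedAt_guide x hU t n).mono fun u hu => hu.guide_eq hU hB
  simpa using this

/-- The stems of conditions below `p` that are generated by elements of `B`. -/
def IsStem (p : Condition) (B : Set (Finset ℕ)) (t : Finset ℕ) : Prop :=
  p.stem ⊆ t ∧ IsFinUnion B (t \ p.stem)

theorem IsStem.eventually {p : Condition} (hU : IsUnionUltrafilter B U) (ht : IsStem p B t) :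
    ∀ᶠ u in U, IsStem p B (t ∪ u) := by
  filter_upwards [hU.concentrates 0, hU.eventually_below p.stem] with u hu hpu
  refine ⟨ht.1.trans Finset.subset_union_left, ?_⟩
  rw [Finset.union_sdiff_distrib, Finset.sdiff_eq_self_of_disjoint hpu.disjoint.symm]
  exact ht.2.union hu.1

/-- If the guiding reals of almost all extensions of `t` agreed, then some condition with stem `t`
would force `x` to be their common value. -/
theorem eventually_guide_ne {p : Condition} (hU : IsUnionUltrafilter B U) (hB : Captures x B)
    (hx : ForcesNew p x) (hBp : Condenses B p.blocks) (ht : IsStem p B t) (z : Real2) :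
    ∀ᶠ u in U, guide x B U (t ∪ u) ≠ z := by
  by_contra hcon
  rw [← Ultrafilter.eventually_not] at hcon
  simp only [not_not] at hcon
  obtain ⟨q, rfl, hqB, hq⟩ := hU.exists_condition (P := fun t => guide x B U t = z) hcon
  refine hx z q ⟨ht.1, hqB.trans hBp, ht.2.mono hBp⟩ fun n =>
    forcesBit_of_forall fun r hr j hj => ?_
  obtain ⟨r', hr', hne⟩ : ∃ r' ≤ r, r'.stem ≠ q.stem := by
    by_cases h : r.stem = q.stem
    · obtain ⟨r', hr', hne⟩ := r.exists_le_forall_stem_ne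
      exact ⟨r', hr', h ▸ hne r' le_rfl⟩
    · exact ⟨r, le_rfl, h⟩
  have hdec : DecidedAt x B r'.stem n j :=
    ⟨r', rfl, (hr'.trans hr).2.1.trans hqB, hj.mono hr'⟩
  rw [← hdec.guide_eq hU hB, hq r' (hr'.trans hr) hne]

end Guide

/-! ### Closed locally countable graphs -/

theorem IsClosedLocallyCountable.isClosed_adj_or_eq {G : SimpleGraph Real2}
    (hG : IsClosedLocallyCountable G) :
    IsClosed {e : Real2 × Real2 | G.Adj e.1 e.2 ∨ e.1 = e.2} := by
  obtain ⟨F, hF, hFG⟩ := isClosed_induced_iff.1 hG.closed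
  have hmem : ∀ e : Real2 × Real2, e.1 ≠ e.2 → (e ∈ F ↔ G.Adj e.1 e.2) := fun e he =>
    Set.ext_iff.1 hFG ⟨e, he⟩
  have : {e : Real2 × Real2 | G.Adj e.1 e.2 ∨ e.1 = e.2} = F ∪ Set.diagonal Real2 := by
    ext e
    by_cases he : e.1 = e.2
    · simp [he]
    · simp [he, hmem e he]
  rw [this]
  exact hF.union isClosed_diagonal

/-- The set of neighbours of `y`, together with `y` itself. -/
def closedNeighbors (G : SimpleGraph Real2) (y : Real2) : Set Real2 := {z | G.Adj y z ∨ y = z}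

theorem IsClosedLocallyCountable.isClosed_closedNeighbors {G : SimpleGraph Real2}
    (hG : IsClosedLocallyCountable G) (y : Real2) : IsClosed (closedNeighbors G y) :=
  hG.isClosed_adj_or_eq.preimage (f := fun z => (y, z)) (by fun_prop)

theorem IsClosedLocallyCountable.countable_closedNeighbors {G : SimpleGraph Real2}
    (hG : IsClosedLocallyCountable G) (y : Real2) : (closedNeighbors G y).Countable :=
  (hG.countable y).union (Set.countable_singleton y |>.mono fun _ h => h.symm)

theorem eventually_forall_eq_imp_mem {O : Set Real2} (hO : IsOpen O) {y : Real2} (hy : y ∈ O) :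
    ∀ᶠ k in atTop, ∀ z : Real2, (∀ j < k, z j = y j) → z ∈ O := by
  obtain ⟨I, u, hu, hI⟩ := isOpen_pi_iff.1 hO y hy
  filter_upwards [eventually_ge_atTop (I.sup id + 1)] with k hk z hz
  refine hI fun i hi => ?_
  have : i ≤ I.sup id := Finset.le_sup (f := id) hi
  rw [hz i (by omega)]
  exact (hu i hi).2

/-- Distinct nonadjacent reals have neighbourhoods without edges between them. -/
theorem IsClosedLocallyCountable.eventually_not_adj {G : SimpleGraph Real2}
    (hG : IsClosedLocallyCountable G) {y y' : Real2} (hne : y ≠ y') (hadj : ¬ G.Adj y y') :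
    ∀ᶠ k in atTop, ∀ z z' : Real2, (∀ j < k, z j = y j) → (∀ j < k, z' j = y' j) →
      ¬ G.Adj z z' := by
  have hnhds : {e : Real2 × Real2 | G.Adj e.1 e.2 ∨ e.1 = e.2}ᶜ ∈ 𝓝 (y, y') :=
    hG.isClosed_adj_or_eq.isOpen_compl.mem_nhds fun h => h.elim hadj hne
  obtain ⟨O, O', hO, hy, hO', hy', hsub⟩ := mem_nhds_prod_iff'.1 hnhds
  filter_upwards [eventually_forall_eq_imp_mem hO hy, eventually_forall_eq_imp_mem hO' hy']
    with k h h' z z' hz hz' hzz'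
  exact hsub (Set.mk_mem_prod (h z hz) (h' z' hz')) (Or.inl hzz')

theorem not_countable_of_perfect {K : Set Real2} (hK : Perfect K) (hne : K.Nonempty) :
    ¬ K.Countable := by
  let := TopologicalSpace.upgradeIsCompletelyMetrizable Real2
  obtain ⟨f, hf, -, hinj⟩ := hK.exists_nat_bool_injection hne
  intro hc
  rw [← Set.image_univ] at hf
  have h := Set.countable_of_injective_of_countable_image hinj.injOn (hc.mono hf)
  rw [Set.countable_univ_iff] at h
  obtain ⟨g, hg⟩ := exists_surjective_nat (ℕ → Bool)
  obtain ⟨n, hn⟩ := hg fun n => !g n n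
  exact Bool.not_ne_self (g n n) (congrFun hn n).symm

section Guide

variable {x : RealName Condition} {B : Set (Finset ℕ)} {U : Ultrafilter (Finset ℕ)}
  {p : Condition} {G : SimpleGraph Real2}

/-- The guiding reals avoid countable closed sets: those in `K` that arise from stems `t` with
`guide (t ∪ u) ∈ K` for almost all `u` accumulate at each other, so that their closure would be a
nonempty perfect subset of `K`. -/
theorem eventually_guide_notMem (hU : IsUnionUltrafilter B U) (hB : Captures x B)
    (hx : ForcesNew p x) (hBp : Condenses B p.blocks) {t : Finset ℕ} (ht : IsStem p B t)
    {K : Set Real2} (hKcl : IsClosed K) (hKc : K.Countable) :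
    ∀ᶠ u in U, guide x B U (t ∪ u) ∉ K := by
  by_contra hcon
  rw [← Ultrafilter.eventually_not] at hcon
  simp only [not_not] at hcon
  let good : Finset ℕ → Prop := fun t => IsStem p B t ∧ guide x B U t ∈ K ∧
    ∀ᶠ u in U, guide x B U (t ∪ u) ∈ K
  have hgood : ∀ t, IsStem p B t → (∀ᶠ u in U, guide x B U (t ∪ u) ∈ K) →
      ∀ᶠ u in U, good (t ∪ u) := fun t ht h => by
    filter_upwards [ht.eventually hU, h, (hU.idem fun u => guide x B U (t ∪ u) ∈ K).1 h]
      with u h1 h2 h3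
    exact ⟨h1, h2, by simpa only [Finset.union_assoc] using h3⟩
  have hpre : Preperfect (guide x B U '' {t | good t}) := by
    rintro _ ⟨t, htg, rfl⟩
    refine accPt_iff_frequently.2 ((tendsto_guide hU hB t).frequently ?_)
    refine Eventually.frequently ?_
    filter_upwards [eventually_guide_ne hU hB hx hBp htg.1 (guide x B U t),
      hgood t htg.1 htg.2.2] with u h1 h2
    exact ⟨h1, Set.mem_image_of_mem _ h2⟩
  obtain ⟨u, hu⟩ := (hgood t ht hcon).exists
  refine not_countable_of_perfect hpre.perfect_closure
    ⟨_, subset_closure (Set.mem_image_of_mem _ hu)⟩ (hKc.mono (closure_minimal ?_ hKcl))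
  rintro _ ⟨t, htg, rfl⟩
  exact htg.2.1

/-- The stems `t` and `t'` are linked if adding the same set to both makes the guiding reals
adjacent, for `U`-almost every set. -/
def Linked (G : SimpleGraph Real2) (x : RealName Condition) (B : Set (Finset ℕ))
    (U : Ultrafilter (Finset ℕ)) (t t' : Finset ℕ) : Prop :=
  ∀ᶠ u in U, G.Adj (guide x B U (t ∪ u)) (guide x B U (t' ∪ u))

/-- A set of stems is unlinked if the guiding reals of its elements are pairwise nonadjacent and
no two of its elements are linked. The second clause makes this property pass from a finite set `S`
to `S ∪ {t ∪ w : t ∈ S}` for almost all `w`. -/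
structure Unlinked (G : SimpleGraph Real2) (p : Condition) (x : RealName Condition)
    (B : Set (Finset ℕ)) (U : Ultrafilter (Finset ℕ)) (S : Set (Finset ℕ)) : Prop where
  isStem : ∀ t ∈ S, IsStem p B t
  not_adj : ∀ t ∈ S, ∀ t' ∈ S, ¬ G.Adj (guide x B U t) (guide x B U t')
  not_linked : ∀ t ∈ S, ∀ t' ∈ S, ¬ Linked G x B U t t'

theorem Linked.symm {t t' : Finset ℕ} (h : Linked G x B U t t') : Linked G x B U t' t :=
  h.mono fun _ hu => hu.symm

theorem Linked.mem_closedNeighbors (hG : IsClosedLocallyCountable G)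
    (hU : IsUnionUltrafilter B U) (hB : Captures x B) {t t' : Finset ℕ}
    (h : Linked G x B U t t') : guide x B U t' ∈ closedNeighbors G (guide x B U t) :=
  hG.isClosed_adj_or_eq.mem_of_tendsto
    ((tendsto_guide hU hB t).prodMk_nhds (tendsto_guide hU hB t'))
    (h.mono fun _ hu => Or.inl hu)

theorem unlinked_singleton {t : Finset ℕ} (ht : IsStem p B t) : Unlinked G p x B U {t} := by
  refine ⟨?_, ?_, ?_⟩
  · rintro _ rfl
    exact ht
  · rintro _ rfl _ rfl
    exact G.irrefl
  · rintro _ rfl _ rfl h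
    obtain ⟨u, hu⟩ := h.exists
    exact G.irrefl hu

theorem Unlinked.eventually (hG : IsClosedLocallyCountable G) (hU : IsUnionUltrafilter B U)
    (hB : Captures x B) (hx : ForcesNew p x) (hBp : Condenses B p.blocks)
    {S : Finset (Finset ℕ)} (hS : Unlinked G p x B U S) :
    ∀ᶠ w in U, Unlinked G p x B U (S ∪ S.image (· ∪ w) : Finset (Finset ℕ)) := by
  have h1 : ∀ᶠ w in U, ∀ t ∈ S, IsStem p B (t ∪ w) :=
    (eventually_all_finset S).2 fun t ht => (hS.isStem t ht).eventually hU
  have h2 : ∀ᶠ w in U, ∀ t ∈ S, ∀ t' ∈ S,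
      guide x B U (t' ∪ w) ∉ closedNeighbors G (guide x B U t) :=
    (eventually_all_finset S).2 fun t _ => (eventually_all_finset S).2 fun t' ht' =>
      eventually_guide_notMem hU hB hx hBp (hS.isStem t' ht')
        (hG.isClosed_closedNeighbors _) (hG.countable_closedNeighbors _)
  have h3 : ∀ᶠ w in U, ∀ t ∈ S, ∀ t' ∈ S,
      ¬ G.Adj (guide x B U (t ∪ w)) (guide x B U (t' ∪ w)) :=
    (eventually_all_finset S).2 fun t ht => (eventually_all_finset S).2 fun t' ht' =>
      Ultrafilter.eventually_not.2 (hS.not_linked t ht t' ht')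
  have h4 : ∀ᶠ w in U, ∀ t ∈ S, ∀ t' ∈ S, ¬ Linked G x B U (t ∪ w) (t' ∪ w) := by
    refine (eventually_all_finset S).2 fun t ht => (eventually_all_finset S).2 fun t' ht' => ?_
    refine Ultrafilter.eventually_not.2 fun h => hS.not_linked t ht t' ht' ?_
    refine (hU.idem fun w => G.Adj (guide x B U (t ∪ w)) (guide x B U (t' ∪ w))).2 ?_
    simpa only [Linked, Finset.union_assoc] using h
  filter_upwards [h1, h2, h3, h4] with w h1 h2 h3 h4
  have hmem : ∀ t, t ∈ ((S ∪ S.image (· ∪ w) : Finset (Finset ℕ)) : Set (Finset ℕ)) →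
      t ∈ S ∨ ∃ t' ∈ S, t' ∪ w = t := by simp
  refine ⟨fun t ht => ?_, fun t ht t' ht' => ?_, fun t ht t' ht' => ?_⟩
  · rcases hmem t ht with hs | ⟨t, hs, rfl⟩
    exacts [hS.isStem t hs, h1 t hs]
  · rcases hmem t ht with hs | ⟨t, hs, rfl⟩ <;> rcases hmem t' ht' with hs' | ⟨t', hs', rfl⟩
    · exact hS.not_adj t hs t' hs'
    · exact fun h => h2 t hs t' hs' (Or.inl h)
    · exact fun h => h2 t' hs' t hs (Or.inl h.symm)
    · exact h3 t hs t' hs'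
  · rcases hmem t ht with hs | ⟨t, hs, rfl⟩ <;> rcases hmem t' ht' with hs' | ⟨t', hs', rfl⟩
    · exact hS.not_linked t hs t' hs'
    · exact fun h => h2 t hs t' hs' (h.mem_closedNeighbors hG hU hB)
    · exact fun h => h2 t' hs' t hs (h.symm.mem_closedNeighbors hG hU hB)
    · exact h4 t hs t' hs'

end Guide

/-! ### Initial segments and bodies of trees -/

theorem restrict_prefix_iff {y : Real2} {n : ℕ} {σ : List Bool} :
    restrict y n <+: σ ↔ ∀ i < n, σ[i]? = some (y i) := by
  simp [restrict, List.prefix_iff_getElem?]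

theorem forcesSegment_restrict {P : Type*} [Preorder P] {q : P} {x : RealName P} {y : Real2}
    {n : ℕ} : ForcesSegment q x (restrict y n) ↔ ∀ i < n, ForcesBit q x i (y i) := by
  simp [ForcesSegment, restrict]

theorem isClosed_body (T : Set (List Bool)) : IsClosed (body T) := by
  have : body T = ⋂ n, (fun (y : Real2) (i : Fin n) => y i) ⁻¹'
      {f : Fin n → Bool | ∃ σ ∈ T, List.ofFn f <+: σ} := by
    ext y
    simp [body, restrict]
  rw [this]
  exact isClosed_iInter fun n => (isClosed_discrete _).preimage (by fun_prop)

/-- A condition cannot decide arbitrarily long initial segments of a new real, so that there is a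
longest one. -/
theorem ForcesNew.exists_isMaxDecided {P : Type*} [Preorder P] {p q : P} {x : RealName P}
    (hx : ForcesNew p x) (hq : q ≤ p) : ∃ σ, IsMaxDecided q x σ := by
  classical
  have hbdd : ∃ N, ∀ σ, ForcesSegment q x σ → σ.length ≤ N := by
    by_contra! h
    choose σ hσ hlen using h
    exact hx (fun n => (σ n)[n]'(hlen n)) q hq fun n => hσ n n (hlen n)
  obtain ⟨σ, hσ, hmax⟩ : ∃ σ, ForcesSegment q x σ ∧
      ∀ τ, ForcesSegment q x τ → τ.length ≤ σ.length := by
    have hspec := Nat.find_spec hbdd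
    rcases h : Nat.find hbdd with _ | M
    · exact ⟨[], by simp [ForcesSegment], fun τ hτ => (hspec τ hτ).trans h.le⟩
    · have hM := Nat.find_min hbdd (m := M) (by omega)
      push Not at hM
      obtain ⟨σ, hσ, hlt⟩ := hM
      exact ⟨σ, hσ, fun τ hτ => (hspec τ hτ).trans (by omega)⟩
  refine ⟨σ, hσ, fun τ hτ => List.prefix_iff_getElem?.2 fun i hi => ?_⟩
  have hi' : i < σ.length := hi.trans_le (hmax τ hτ)
  rw [List.getElem?_eq_getElem hi', (hσ i hi').unique (hτ i hi)]

/-! ### The fusion -/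

/-- `k` separates the reals `y t`, `t ∈ S`: if `y t` and `y t'` are distinct, then no edge of `G`
joins the neighbourhoods of `y t` and `y t'` determined by their first `k` bits. -/
def Separates (G : SimpleGraph Real2) (y : Finset ℕ → Real2) (k : ℕ) (S : Set (Finset ℕ)) :
    Prop :=
  ∀ t ∈ S, ∀ t' ∈ S, y t ≠ y t' → ∀ z z' : Real2, (∀ j < k, z j = y t j) →
    (∀ j < k, z' j = y t' j) → ¬ G.Adj z z'

theorem Unlinked.eventually_separates {x : RealName Condition} {B : Set (Finset ℕ)}
    {U : Ultrafilter (Finset ℕ)} {p : Condition} {G : SimpleGraph Real2}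
    (hG : IsClosedLocallyCountable G) {S : Finset (Finset ℕ)}
    (hS : Unlinked G p x B U S) : ∀ᶠ k in atTop, Separates G (guide x B U) k S := by
  refine (eventually_all_finset S).2 fun t ht => (eventually_all_finset S).2 fun t' ht' => ?_
  by_cases h : guide x B U t = guide x B U t'
  · exact Eventually.of_forall fun _ hne => absurd h hne
  · exact (hG.eventually_not_adj h (hS.not_adj t ht t' ht')).mono fun _ hk _ => hk

/-- A fusion below `p` in which the guiding reals `y` of the stems generated up to stage `n`
determine those of all later stems up to `k n`, and in which no edges of `G` join the resulting
neighbourhoods of distinct guiding reals. -/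
theorem exists_separating_fusion {G : SimpleGraph Real2} (hG : IsClosedLocallyCountable G)
    {x : RealName Condition} {p : Condition} (hx : ForcesNew p x) :
    ∃ (B : Set (Finset ℕ)) (y : Finset ℕ → Real2) (a : ℕ → Finset ℕ) (k : ℕ → ℕ),
      Condenses B p.blocks ∧
      (∀ (r : Condition) (n : ℕ) (i : Bool), Condenses r.blocks B → ForcesBit r x n i →
        y r.stem n = i) ∧
      StrictMono k ∧ (∀ n, Separates G y (k n) (stems p.stem a n)) ∧
      (∀ n, ∀ t ∈ stems p.stem a n, ∀ j < k n, y (t ∪ a n) j = y t j) ∧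
      (∀ n, IsFinUnion B (a n)) ∧ (∀ n, (a n).Nonempty) ∧
      ∀ n, ∀ t ∈ stems p.stem a n, Below t (a n) := by
  obtain ⟨B, hBset, hBp, hB⟩ := exists_captures x p.isBlockSet
  obtain ⟨U, hU⟩ := exists_isUnionUltrafilter hBset
  obtain ⟨a, k, hk, hinv, hstep, hfu, hne, hbel⟩ := hU.exists_fusion (s := p.stem) (k₀ := 0)
    (Inv := fun k S => Unlinked G p x B U S ∧ Separates G (guide x B U) k S)
    (Step := fun k t w => ∀ j < k, guide x B U (t ∪ w) j = guide x B U t j)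
    (by
      rw [Finset.coe_singleton]
      refine ⟨unlinked_singleton ⟨subset_rfl, by simpa using IsFinUnion.empty B⟩, ?_⟩
      rintro _ rfl _ rfl h
      exact absurd rfl h) (by
      rintro k S ⟨hS, -⟩
      filter_upwards [hS.eventually hG hU hB hx hBp,
        (eventually_all_finset S).2 fun t _ => eventually_guide_eq hU hB t k] with w hw h
      obtain ⟨k', hk', hlt⟩ :=
        ((hw.eventually_separates hG).and (eventually_gt_atTop k)).exists
      exact ⟨h, k', hlt, hw, hk'⟩)
  exact ⟨B, guide x B U, a, k, hBp,
    fun r n i hrB hr => DecidedAt.guide_eq hU hB ⟨r, rfl, hrB, hr⟩, hk, fun n => (hinv n).2,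
    hstep, hfu, hne, hbel⟩

theorem isFusion_image_Ici {A B : Set (Finset ℕ)} {s : Finset ℕ} {a : ℕ → Finset ℕ}
    (hBA : Condenses B A) (hfu : ∀ n, IsFinUnion B (a n)) (hne : ∀ n, (a n).Nonempty)
    (hbel : ∀ n, ∀ t ∈ stems s a n, Below t (a n)) : IsFusion A (a '' Set.Ici 0) := by
  refine ⟨fun n => a '' Set.Ici n, a, ?_, isBlockSet_image_Ici hne hbel,
    fun n => ⟨⟨n, Set.self_mem_Ici, rfl⟩, ?_⟩, fun n => condenses_of_subset ?_, ?_⟩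
  · rintro _ ⟨n, -, rfl⟩
    exact (hfu n).mono hBA
  · rintro _ ⟨j, hj, rfl⟩ hjn
    exact below_of_lt hbel (lt_of_le_of_ne hj fun h => hjn (congrArg a h.symm))
  · rintro _ ⟨j, hj, rfl⟩
    exact ⟨⟨j, Nat.le_of_succ_le hj, rfl⟩, below_of_lt hbel hj⟩
  · ext b
    simp

/-- The fusion `q` satisfies `body (nameTree q x) = closure {y t}`, where `t` ranges over the stems
generated by the blocks of `q` and `y t` is the guiding real of `t`. -/
theorem exists_fusion_isIndepSet_body {G : SimpleGraph Real2} (hG : IsClosedLocallyCountable G)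
    {x : RealName Condition} {p : Condition} (hx : ForcesNew p x) :
    ∃ q ≤ p, q.stem = p.stem ∧ IsFusion p.blocks q.blocks ∧ IsClosed (body (nameTree q x)) ∧
      G.IsIndepSet (body (nameTree q x)) ∧ ForcesMemClosed q x (body (nameTree q x)) := by
  obtain ⟨B, y, a, k, hBp, hy, hk, hsep, hstep, hfu, hne, hbel⟩ :=
    exists_separating_fusion hG hx
  have hBq : Condenses (a '' Set.Ici 0) B := by
    rintro _ ⟨n, -, rfl⟩
    exact hfu n
  let q : Condition := seqCondition hne hbel 0 p.stem (self_mem_stems 0)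
  have hqp : q ≤ p := Condition.le_of_stem_eq rfl (hBq.trans hBp)
  -- The guiding reals of all extensions of a stem of stage `m` agree up to `k m`.
  have hagree : ∀ m, ∀ t ∈ stems p.stem a m, ∀ n, m ≤ n → ∀ J ⊆ Finset.Ico m n,
      t ∪ J.biUnion a ∈ stems p.stem a n ∧ ∀ j < k m, y (t ∪ J.biUnion a) j = y t j := by
    intro m t ht n hmn J hJ
    exact union_biUnion_mem_stems (R := fun t u => ∀ j < k m, y u j = y t j)
      (fun _ _ _ => rfl) (fun _ _ _ h h' j hj => (h' j hj).trans (h j hj))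
      (fun n hn t ht j hj => hstep n t ht j (hj.trans_le (hk.monotone hn))) ht hmn hJ
  have hstem : ∀ r ≤ q, ∃ n, r.stem ∈ stems p.stem a n := fun r hr => by
    obtain ⟨n, hn, J, hJ, hrJ⟩ := exists_stem_eq_of_le_seqCondition hr
    exact ⟨n, hrJ ▸ (hagree 0 _ (self_mem_stems 0) n hn J hJ).1⟩
  have hforce : ∀ m t (ht : t ∈ stems p.stem a m), ∀ j < k m,
      ForcesBit (seqCondition hne hbel m t ht) x j (y t j) := by
    intro m t ht j hj
    refine forcesBit_of_forall fun r hr i hi => ?_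
    obtain ⟨n, hn, J, hJ, hrJ⟩ := exists_stem_eq_of_le_seqCondition hr
    rw [← hy r j i ((hr.trans (seqCondition_le ht)).2.1.trans hBq) hi, hrJ]
    exact (hagree m t ht n hn J hJ).2 j hj
  -- The body of the name tree consists of the limits of guiding reals.
  have hbody : ∀ n, ∀ t ∈ stems p.stem a n, y t ∈ body (nameTree q x) := by
    intro n t ht l
    have ht' : t ∈ stems p.stem a (max n l) := stems_mono (le_max_left _ _) ht
    have hle := seqCondition_le (hne := hne) (hbel := hbel) ht'
    obtain ⟨σ, hσ⟩ := hx.exists_isMaxDecided (hle.trans hqp)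
    refine ⟨σ, ⟨_, hle, hσ⟩, hσ.2 _ (forcesSegment_restrict.2 fun i hi => ?_)⟩
    exact hforce _ t ht' i (hi.trans_le ((le_max_right _ _).trans hk.le_apply))
  have hlim : ∀ z ∈ body (nameTree q x), ∀ l, ∃ n, ∃ t ∈ stems p.stem a n,
      ∀ j < l, z j = y t j := by
    intro z hz l
    obtain ⟨σ, ⟨r, hr, hσ⟩, hzσ⟩ := hz l
    obtain ⟨n, hn⟩ := hstem r hr
    refine ⟨n, r.stem, hn, fun j hj => ?_⟩
    obtain ⟨hjσ, hjz⟩ := List.getElem?_eq_some_iff.1 (restrict_prefix_iff.1 hzσ j hj)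
    rw [← hjz, hy r j _ (hr.2.1.trans hBq) (hσ.1 j hjσ)]
  have hback : ∀ m n, ∀ t ∈ stems p.stem a n, ∃ t' ∈ stems p.stem a m,
      ∀ j < k m, y t j = y t' j := by
    intro m n t ht
    induction n generalizing t with
    | zero => exact ⟨t, stems_mono m.zero_le ht, fun _ _ => rfl⟩
    | succ n ih =>
      rcases lt_or_ge n m with hnm | hmn
      · exact ⟨t, stems_mono hnm ht, fun _ _ => rfl⟩
      · rcases mem_stems_succ.1 ht with hs | ⟨u, hs, rfl⟩
        · exact ih t hs
        · obtain ⟨t', ht', h⟩ := ih u hs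
          exact ⟨t', ht', fun j hj =>
            (hstep n u hs j (hj.trans_le (hk.monotone hmn))).trans (h j hj)⟩
  have happrox : ∀ z ∈ body (nameTree q x), ∀ m, ∃ t ∈ stems p.stem a m,
      ∀ j < k m, z j = y t j := by
    intro z hz m
    obtain ⟨n, t, ht, h⟩ := hlim z hz (k m)
    obtain ⟨t', ht', h'⟩ := hback m n t ht
    exact ⟨t', ht', fun j hj => (h j hj).trans (h' j hj)⟩
  refine ⟨q, hqp, rfl, isFusion_image_Ici hBp hfu hne hbel, isClosed_body _, ?_, ?_⟩
  · intro z hz z' hz' hzz' hadj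
    obtain ⟨l, hl⟩ := Function.ne_iff.1 hzz'
    obtain ⟨t, ht, h⟩ := happrox z hz (l + 1)
    obtain ⟨t', ht', h'⟩ := happrox z' hz' (l + 1)
    have hlk : l < k (l + 1) := hk.le_apply
    refine hsep (l + 1) t ht t' ht' (fun heq => hl ?_) z z' h h' hadj
    rw [h l hlk, h' l hlk, heq]
  · intro l r hr
    obtain ⟨n, hn⟩ := hstem r hr
    have hn' : r.stem ∈ stems p.stem a (max n l) := stems_mono (le_max_left _ _) hn
    refine ⟨r.tail (a (max n l)), r.tail_le _, y r.stem, hbody n _ hn,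
      forcesSegment_restrict.2 fun i hi => ?_⟩
    exact (hforce _ _ hn' i (hi.trans_le ((le_max_right _ _).trans hk.le_apply))).mono
      (tail_le_seqCondition hr hn')

end MatetForcing

theorem mainTheorem9 (G : SimpleGraph MatetForcing.Real2)
    (hG : MatetForcing.IsClosedLocallyCountable G) :
    (∀ (x : MatetForcing.RealName MatetForcing.Condition) (p : MatetForcing.Condition),
      ∃ q ≤ p, ∃ F : Set MatetForcing.Real2,
        IsClosed F ∧ G.IsIndepSet F ∧ MatetForcing.ForcesMemClosed q x F) ∧
    (∀ (x : MatetForcing.RealName MatetForcing.Condition) (p : MatetForcing.Condition),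
      MatetForcing.ForcesNew p x →
      ∃ q ≤ p, q.stem = p.stem ∧ MatetForcing.IsFusion p.blocks q.blocks ∧
        IsClosed (MatetForcing.body (MatetForcing.nameTree q x)) ∧
        G.IsIndepSet (MatetForcing.body (MatetForcing.nameTree q x)) ∧
        MatetForcing.ForcesMemClosed q x (MatetForcing.body (MatetForcing.nameTree q x))) := by
  refine ⟨fun x p => ?_, fun x p hx => MatetForcing.exists_fusion_isIndepSet_body hG hx⟩
  by_cases hx : MatetForcing.ForcesNew p x
  · obtain ⟨q, hqp, -, -, hcl, hind, hmem⟩ :=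
      MatetForcing.exists_fusion_isIndepSet_body hG hx
    exact ⟨q, hqp, _, hcl, hind, hmem⟩
  · -- Some extension forces `x` to be a ground-model real, and a singleton is independent.
    simp only [MatetForcing.ForcesNew, not_forall, not_not] at hx
    obtain ⟨y, q, hqp, hqy⟩ := hx
    refine ⟨q, hqp, {y}, isClosed_singleton, Set.pairwise_singleton _ _, fun n r hr => ?_⟩
    exact ⟨r, le_rfl, y, rfl, MatetForcing.forcesSegment_restrict.2 fun i _ => (hqy i).mono hr⟩
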